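/- All structures are finite, nonempty and relational. A generalized quantifier $Q_{\mathcal K}$ is given by a finite relational vocabulary $\tau=\{R_1,\dots,R_m\}$ and an isomorphism-closed class $\mathcal K$ of finite $\tau$-structures. It binds, in formulas $\psi_1,\dots,\psi_m$, tuples $\vec y_1,\dots,\vec y_m$ of distinct variables with $|\vec y_i|=\mathrm{ar}(R_i)$: the formula $Q_{\mathcal K}\,\vec y_1,\dots,\vec y_m\,(\psi_1,\dots,\psi_m)$ is true in $(\mathfrak A,\alpha)$ if and only if the $\tau$-structure with universe $A$ and relations $R_i=\{\vec b \mid (\mathfrak A,\alpha[\vec b/\vec y_i])\models\psi_i\}$ belongs to $\mathcal K$. For a collection $\mathbf Q$ of quantifiers, $L^k_{\infty\omega}(\mathbf Q)$ is the closure of first-order logic with $k$ variables under arbitrary (infinitary) conjunctions and disjunctions and under the quantifiers in $\mathbf Q$, and $L^\omega_{\infty\omega}(\mathbf Q)=\bigcup_{k}L^k_{\infty\omega}(\mathbf Q)$. A class $\mathcal C$ of finite structures of a fixed vocabulary is definable in this logic if there is a sentence $\varphi$ of it such that, for every finite structure $\mathfrak A$ of that vocabulary, $\mathfrak A\in\mathcal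 C$ if and only if $\mathfrak A\models\varphi$. For $\ell\ge 3$ and a finite set $A$, let $n^\ell_A\colon A^\ell\to A$ be the partial near-unanimity function: $n^\ell_A(a_1,\dots,a_\ell)=a$ if and only if $|\{i\mid a_i=a\}|\ge \ell-1$ (undefined if there is no such $a$). For $R\subseteq A^r$ let $n^\ell_A(R)$ be the set of all $r$-tuples obtained by applying $n^\ell_A$ componentwise to $\ell$ tuples of $R$. A quantifier $Q_{\mathcal K}$ is $\mathcal N_\ell$-closed if, for all $\tau$-structures $\mathfrak A,\mathfrak B$ with the same universe $A$: whenever $\mathfrak B\in\mathcal K$ and $R^{\mathfrak A}\subseteq n^\ell_A(R^{\mathfrak B})\cup R^{\mathfrak B}$ for each $R\in\tau$, also $\mathfrak A\in\mathcal K$. Let $\mathbf Q_{\mathcal N_\ell}$ be the collection of all $\mathcal N_\ell$-closed quantifiers. Let $\mathfrak C_\ell$ be the structure with universe $\mathbb Z/2\mathbb Z$ and the two $\ell$-ary relations $R_0=\{(b_1,\dots,b_\ell)\mid\sum_i b_i=0\}$ and $R_1=\{(b_1,\dots,b_\ell)\mid\sum_i b_i=1\}$, and let $\mathsf{CSP}(\mathfrak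 C_\ell)$ be the class of all finite structures over the same vocabulary that have a homomorphism to $\mathfrak C_\ell$ (that is, solvability of systems of linear equations over $\mathbb Z/2\mathbb Z$ with $\ell$ variables per equation). Theorem. For every $\ell\ge 3$, $\mathsf{CSP}(\mathfrak C_\ell)$ is not definable in $L^\omega_{\infty\omega}(\mathbf Q_{\mathcal N_\ell})$. -/

import Mathlib

open scoped FirstOrder

universe u v

namespace GenQuant

/-! ### Generalized quantifiers -/

/-- A class of finite nonempty structures of the vocabulary `L`, as a predicate. -/
abbrev StructureClass (L : FirstOrder.Language.{0, 0}) : Type (v + 1) :=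
  ∀ (A : Type v) [Finite A] [Nonempty A] [L.Structure A], Prop

/-- A generalized quantifier `Q_K`: a finite relational vocabulary together with a class `K` of
finite structures of that vocabulary which is closed under isomorphism. -/
structure Quantifier : Type (v + 1) where
  vocab : FirstOrder.Language.{0, 0}
  relational : vocab.IsRelational
  finite : Finite vocab.Symbols
  mem : StructureClass.{v} vocab
  mem_of_equiv : ∀ (A B : Type v) [Finite A] [Nonempty A] [Finite B] [Nonempty B]
    [vocab.Structure A] [vocab.Structure B], (A ≃[vocab] B) → mem A → mem B

/-- The structure of a relational vocabulary with universe `A` and prescribed relations. -/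
abbrev structureOfRel (L : FirstOrder.Language.{0, 0}) (hL : L.IsRelational) {A : Type v}
    (S : ∀ r, L.Relations r → Set (Fin r → A)) : L.Structure A where
  funMap {n} f _ := ((hL n).false f).elim
  RelMap {n} R a := a ∈ S n R

/-! ### Infinitary logic with generalized quantifiers -/

/-- Formulas of `L^k_{∞ω}(𝒬)` over the relational vocabulary `L`: infinitary first-order formulas
with variables `x_0, …, x_{k-1}`, extended by the quantifiers in `𝒬`. In `quant`, every relation
symbol `R` of the vocabulary of `Q` is interpreted by a formula `ψ R` with its own tuple `y R` of
distinct bound variables. -/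
inductive QFormula (L : FirstOrder.Language.{0, 0}) (𝒬 : Set Quantifier.{v}) (k : ℕ) :
    Type (max (u + 1) (v + 1))
  | equal (x y : Fin k) : QFormula L 𝒬 k
  | rel {r : ℕ} (R : L.Relations r) (x : Fin r → Fin k) : QFormula L 𝒬 k
  | neg (φ : QFormula L 𝒬 k) : QFormula L 𝒬 k
  | conj {ι : Type u} (φ : ι → QFormula L 𝒬 k) : QFormula L 𝒬 k
  | disj {ι : Type u} (φ : ι → QFormula L 𝒬 k) : QFormula L 𝒬 k
  | ex (x : Fin k) (φ : QFormula L 𝒬 k) : QFormula L 𝒬 k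
  | all (x : Fin k) (φ : QFormula L 𝒬 k) : QFormula L 𝒬 k
  | quant (Q : Quantifier.{v}) (hQ : Q ∈ 𝒬)
      (y : ∀ r, Q.vocab.Relations r → (Fin r ↪ Fin k))
      (ψ : ∀ r, Q.vocab.Relations r → QFormula L 𝒬 k) : QFormula L 𝒬 k

namespace QFormula

variable {L : FirstOrder.Language.{0, 0}} {𝒬 : Set Quantifier.{v}} {k : ℕ}

/-- The free variables of a formula. -/
def freeVars : QFormula.{u, v} L 𝒬 k → Set (Fin k)
  | equal x y => {x, y}
  | rel _ x => Set.range x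
  | neg φ => φ.freeVars
  | conj φ => ⋃ i, (φ i).freeVars
  | disj φ => ⋃ i, (φ i).freeVars
  | ex x φ => φ.freeVars \ {x}
  | all x φ => φ.freeVars \ {x}
  | quant Q _ y ψ => ⋃ (r : ℕ) (R : Q.vocab.Relations r), (ψ r R).freeVars \ Set.range (y r R)

/-- Truth of a formula in the structure `A` under the assignment `α`. The assignment
`α[b/y]` is `Function.extend y b α`. -/
def Realize (A : Type v) [Finite A] [Nonempty A] [L.Structure A] :
    QFormula.{u, v} L 𝒬 k → (Fin k → A) → Prop
  | equal x y, α => α x = α y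
  | rel R x, α => FirstOrder.Language.Structure.RelMap R (fun j => α (x j))
  | neg φ, α => ¬ φ.Realize A α
  | conj φ, α => ∀ i, (φ i).Realize A α
  | disj φ, α => ∃ i, (φ i).Realize A α
  | ex x φ, α => ∃ a : A, φ.Realize A (Function.update α x a)
  | all x φ, α => ∀ a : A, φ.Realize A (Function.update α x a)
  | quant Q _ y ψ, α =>
      @Quantifier.mem Q A _ _ (structureOfRel Q.vocab Q.relational
        (fun r R => {b | (ψ r R).Realize A (Function.extend (y r R) b α)}))

/-- A sentence is a formula without free variables. -/
def IsSentence (φ : QFormula.{u, v} L 𝒬 k) : Prop := φ.freeVars = ∅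

/-- `A ⊨ φ`, for a sentence `φ` (whose truth does not depend on the assignment). -/
def Models (A : Type v) [Finite A] [Nonempty A] [L.Structure A] (φ : QFormula.{u, v} L 𝒬 k) :
    Prop := ∀ α : Fin k → A, φ.Realize A α

end QFormula

/-- The class `K` of finite structures is definable in `L^ω_{∞ω}(𝒬) = ⋃_k L^k_{∞ω}(𝒬)`. -/
def IsDefinable {L : FirstOrder.Language.{0, 0}} (𝒬 : Set Quantifier.{v}) (K : StructureClass.{v} L) : Prop :=
  ∃ (k : ℕ) (φ : QFormula.{u, v} L 𝒬 k), φ.IsSentence ∧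
    ∀ (A : Type v) [Finite A] [Nonempty A] [L.Structure A], K A ↔ φ.Models A

/-! ### Closure of quantifiers under families of partial functions -/

/-- A family of `n`-ary partial functions: a partial function `p_A : A^n → A` for each finite set
`A`. -/
abbrev PartialFamily (n : ℕ) : Type (v + 1) :=
  ∀ (A : Type v) [Finite A], (Fin n → A) →. A

/-- For `R ⊆ A^r`, the relation `p(R)` of all tuples obtained by applying the partial function `p`
componentwise to `n` tuples of `R`. -/
def applyRel {A : Type v} {n r : ℕ} (p : (Fin n → A) →. A) (R : Set (Fin r → A)) :
    Set (Fin r → A) :=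
  {c | ∃ a : Fin n → Fin r → A, (∀ i, a i ∈ R) ∧ ∀ j, c j ∈ p (fun i => a i j)}

/-- `Q_K` is `P`-closed: if `𝔅 ∈ K` and `𝔄 ≤ p_A(𝔅) ∪ 𝔅`, then `𝔄 ∈ K`. -/
def Quantifier.IsClosed {n : ℕ} (P : PartialFamily.{v} n) (Q : Quantifier.{v}) : Prop :=
  ∀ (A : Type v) [Finite A] [Nonempty A] (𝔄 𝔅 : Q.vocab.Structure A),
    @Quantifier.mem Q A _ _ 𝔅 →
    (∀ (r : ℕ) (R : Q.vocab.Relations r),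
      {a : Fin r → A | 𝔄.RelMap R a} ⊆
        applyRel (P A) {a | 𝔅.RelMap R a} ∪ {a | 𝔅.RelMap R a}) →
    @Quantifier.mem Q A _ _ 𝔄

/-- `𝒬_P`: all `P`-closed quantifiers. -/
def closedQuantifiers {n : ℕ} (P : PartialFamily.{v} n) : Set Quantifier.{v} :=
  {Q | Q.IsClosed P}

/-- The family `N_ℓ` of partial near-unanimity functions: `n_A(a_1, …, a_ℓ)` is the value that
occurs at least `ℓ - 1` times among `a_1, …, a_ℓ`, and is undefined if there is none. -/
noncomputable def nearUnanimity (ℓ : ℕ) : PartialFamily.{v} ℓ := fun A _ a =>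
  ⟨∃ b : A, ℓ - 1 ≤ {i | a i = b}.ncard, fun h => h.choose⟩

theorem mem_nearUnanimity {ℓ : ℕ} (hℓ : 3 ≤ ℓ) {A : Type v} [Finite A] (a : Fin ℓ → A) (b : A) :
    b ∈ nearUnanimity ℓ A a ↔ ℓ - 1 ≤ {i | a i = b}.ncard := by
  have key : ∀ b c : A, ℓ - 1 ≤ {i | a i = b}.ncard → ℓ - 1 ≤ {i | a i = c}.ncard → b = c := by
    intro b c hb hc
    by_contra hne
    have hd : Disjoint {i | a i = b} {i | a i = c} := by
      rw [Set.disjoint_left]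
      intro i hi hi'
      exact hne (hi.symm.trans hi')
    have h1 := Set.ncard_union_eq hd (Set.toFinite _) (Set.toFinite _)
    have h2 := Set.ncard_le_card ({i | a i = b} ∪ {i | a i = c})
    rw [Nat.card_fin] at h2
    omega
  constructor
  · rintro ⟨h, rfl⟩
    exact h.choose_spec
  · intro hb
    exact ⟨⟨b, hb⟩, key _ _ (Exists.intro b hb : ∃ b : A, ℓ - 1 ≤ {i | a i = b}.ncard).choose_spec hb⟩

/-! ### Constraint satisfaction -/

/-- `CSP(𝔅)`: the class of finite structures that have a homomorphism to `𝔅`. -/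
def CSP (L : FirstOrder.Language.{0, 0}) (B : Type) [L.Structure B] : StructureClass.{v} L :=
  fun A _ _ _ => Nonempty (A →[L] B)

/-- The two relation symbols `R_0` and `R_1`, both `ℓ`-ary. -/
inductive ParityRel (ℓ : ℕ) : ℕ → Type
  | R₀ : ParityRel ℓ ℓ
  | R₁ : ParityRel ℓ ℓ

/-- The relational vocabulary `{R_0, R_1}`. -/
def parityLang (ℓ : ℕ) : FirstOrder.Language.{0, 0} := ⟨fun _ => Empty, ParityRel ℓ⟩

/-- The structure `ℭ_ℓ` with universe `ℤ/2ℤ`, where `R_0` and `R_1` consist of the `ℓ`-tuples with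
sum `0` and with sum `1`. -/
instance parityStructure (ℓ : ℕ) : (parityLang ℓ).Structure (ZMod 2) where
  funMap f _ := Empty.elim f
  RelMap {n} (R : ParityRel ℓ n) (b : Fin n → ZMod 2) :=
    match R with
    | .R₀ => ∑ i, b i = 0
    | .R₁ => ∑ i, b i = 1

end GenQuant

/-! Equations are placed at the vertices of an `ℓ`-regular bipartite graph, with an unknown for each
edge. Charge 0 is solvable; a single charge is not, since boundaries have total 0 modulo 2. Adding a
chain to the second components moves the charge, and `k` variables cannot detect it at a vertex they
do not touch. The obstacle is that an `N_ℓ`-closed quantifier lets one tuple be answered by `ℓ`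
tuples, of which at most one may err at each coordinate. So, before the challenge, the charge is
moved to a hub `y` all of whose `ℓ` lines miss the edges in use; this fixes the bijection. After the
challenge it can escape from `y` along any of `ℓ` edge-disjoint zigzags to a clean point. The `ℓ`
escapes are the `ℓ` answers, and disjointness makes near-unanimity return the challenge
(`Linked.exists_forall_answers`). Lines in consecutive directions are transversal, so hubs and clean
points exist by counting once `p > k * ℓ`. Induction on formulas (`Linked.holds`) concludes. -/

namespace GenQuant

/-! ### Zigzag chains in a bipartite Cayley graph over the plane `𝔽_p²` -/

namespace Parity

variable {ℓ p : ℕ}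

/-- The affine plane over `ℤ/pℤ`. -/
abbrev Plane (p : ℕ) : Type := ZMod p × ZMod p

/-- The edge `(x, i)` joins the white copy of `x` to the black copy of `x + pt i`. -/
abbrev Edge (ℓ p : ℕ) : Type := Plane p × Fin ℓ

/-- The vertices: white (`inl`) and black (`inr`) copies of the points of the plane. -/
abbrev Vert (p : ℕ) : Type := Plane p ⊕ Plane p

/-- The points `(i, i²)`. -/
def pt (p : ℕ) (i : Fin ℓ) : Plane p := (((i : ℕ) : ZMod p), ((i : ℕ) : ZMod p) ^ 2)

/-- The direction from one point of the parabola to the (cyclically) next one. -/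
def dir (p : ℕ) (i : Fin ℓ) : Plane p := pt p i - pt p (finRotate ℓ i)

/-- The `i`-th edge at a vertex. -/
def inc : Vert p → Fin ℓ → Edge ℓ p
  | .inl x, i => (x, i)
  | .inr y, i => (y - pt p i, i)

/-- The boundary of a chain modulo 2. -/
def bdry (t : Edge ℓ p → ZMod 2) (v : Vert p) : ZMod 2 := ∑ i, t (inc v i)

/-- The charge concentrated at the white copy of `x`. -/
def charge (x : Plane p) : Vert p → ZMod 2 := Pi.single (.inl x) 1

/-! ### Chains modulo 2 and their boundaries. -/

theorem bdry_add (t t' : Edge ℓ p → ZMod 2) : bdry (t + t') = bdry t + bdry t' := by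
  funext v
  simp [bdry, Finset.sum_add_distrib]

theorem bdry_zero : bdry (0 : Edge ℓ p → ZMod 2) = 0 := by
  funext v
  simp [bdry]

theorem bdry_single (x : Plane p) (i : Fin ℓ) :
    bdry (Pi.single (x, i) 1) = charge x + Pi.single (.inr (x + pt p i)) 1 := by
  funext v
  rcases v with y | y
  · simp only [bdry, inc, charge, Pi.add_apply, Pi.single_apply, Prod.mk.injEq, Sum.inl.injEq,
      reduceCtorEq, if_false, add_zero]
    by_cases h : y = x <;> simp [h]
  · simp only [bdry, inc, charge, Pi.add_apply, Pi.single_apply, Prod.mk.injEq, Sum.inr.injEq,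
      reduceCtorEq, if_false, zero_add]
    rw [Finset.sum_eq_single i]
    · simp [sub_eq_iff_eq_add]
    · intro j _ hj
      simp [hj]
    · simp

theorem charge_add_self (x : Plane p) : charge x + charge x = 0 := by
  funext v
  exact CharTwo.add_self_eq_zero _

/-- The path with `2 * n` edges that starts at the white copy of `x` and alternates between edges
of the classes `i` and `finRotate ℓ i`. -/
def zigzag (x : Plane p) (i : Fin ℓ) (n : ℕ) : Edge ℓ p → ZMod 2 :=
  ∑ m ∈ Finset.range n, (Pi.single (x + (m : ZMod p) • dir p i, i) 1 +
    Pi.single (x + ((m : ZMod p) + 1) • dir p i, finRotate ℓ i) 1)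

theorem bdry_zigzag (x : Plane p) (i : Fin ℓ) (n : ℕ) :
    bdry (zigzag x i n) = charge x + charge (x + (n : ZMod p) • dir p i) := by
  induction n with
  | zero => simp [zigzag, bdry_zero, charge_add_self]
  | succ n ih =>
    have hb : x + ((n : ZMod p) + 1) • dir p i + pt p (finRotate ℓ i) =
        x + (n : ZMod p) • dir p i + pt p i := by
      rw [add_smul, one_smul, dir]
      abel
    have h2 : ∀ a b c d : Vert p → ZMod 2, a + b + (b + d + (c + d)) = a + c := by
      intro a b c d
      funext v
      simp only [Pi.add_apply]
      linear_combination CharTwo.add_self_eq_zero (b v) + CharTwo.add_self_eq_zero (d v)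
    rw [zigzag, Finset.sum_range_succ, bdry_add, ← zigzag, ih, bdry_add, bdry_single, bdry_single,
      hb, h2]
    push_cast
    rfl

theorem exists_of_zigzag_ne_zero {x : Plane p} {i : Fin ℓ} {n : ℕ} {e : Edge ℓ p}
    (h : zigzag x i n e ≠ 0) : ∃ m < n, e = (x + (m : ZMod p) • dir p i, i) ∨
      e = (x + ((m : ZMod p) + 1) • dir p i, finRotate ℓ i) := by
  by_contra! hne
  apply h
  rw [zigzag, Finset.sum_apply]
  refine Finset.sum_eq_zero fun m hm => ?_
  obtain ⟨h1, h2⟩ := hne m (Finset.mem_range.1 hm)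
  rw [Pi.add_apply, Pi.single_eq_of_ne h1, Pi.single_eq_of_ne h2, add_zero]

theorem zigzag_eq_zero {T : Set (Plane p)} {x : Plane p} {i : Fin ℓ}
    (h : ∀ s : ZMod p, x + s • dir p i ∉ T) (n : ℕ) {e : Edge ℓ p} (he : e.1 ∈ T) :
    zigzag x i n e = 0 := by
  by_contra hne
  obtain ⟨m, -, rfl | rfl⟩ := exists_of_zigzag_ne_zero hne
  · exact h _ he
  · exact h _ he

/-- The universe of the structures: two copies of every edge. -/
abbrev Carrier (ℓ p : ℕ) : Type v := ULift.{v} (Edge ℓ p × ZMod 2)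

/-- Add the chain `t` to the second components. -/
def shift (t : Edge ℓ p → ZMod 2) : Carrier.{v} ℓ p ≃ Carrier.{v} ℓ p :=
  Function.Involutive.toPerm (fun a => ⟨(a.down.1, a.down.2 + t a.down.1)⟩) fun a => by
    simp [add_assoc, CharTwo.add_self_eq_zero]

theorem shift_apply (t : Edge ℓ p → ZMod 2) (a : Carrier.{v} ℓ p) :
    shift t a = ⟨(a.down.1, a.down.2 + t a.down.1)⟩ := rfl

theorem shift_shift (t : Edge ℓ p → ZMod 2) (a : Carrier.{v} ℓ p) : shift t (shift t a) = a :=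
  (shift t).symm_apply_apply a

theorem shift_add (t t' : Edge ℓ p → ZMod 2) (a : Carrier.{v} ℓ p) :
    shift (t + t') a = shift t (shift t' a) := by
  simp only [shift_apply, Pi.add_apply]
  congr 2
  ring

theorem shift_eq_self {t : Edge ℓ p → ZMod 2} {a : Carrier.{v} ℓ p} (h : t a.down.1 = 0) :
    shift t a = a := by
  simp [shift_apply, h]

/-- The points of the plane whose white copies are ends of edges used by the assignment `α`. -/
def touched {k : ℕ} (α : Fin k → Carrier.{v} ℓ p) : Set (Plane p) :=
  Set.range fun j => (α j).down.1.1

theorem touched_ncard_le {k : ℕ} (α : Fin k → Carrier.{v} ℓ p) : (touched α).ncard ≤ k := by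
  rw [touched, ← Set.image_univ]
  refine (Set.ncard_image_le (Set.toFinite _)).trans ?_
  rw [Set.ncard_univ, Nat.card_fin]

theorem finRotate_ne (hℓ : 3 ≤ ℓ) (i : Fin ℓ) :
    finRotate ℓ i ≠ i ∧ finRotate ℓ (finRotate ℓ i) ≠ i := by
  obtain ⟨n, rfl⟩ := Nat.exists_eq_add_of_le' hℓ
  simp only [finRotate_apply]
  constructor
  · simp
  · rw [add_assoc]
    intro h
    have := congrArg Fin.val (add_eq_left.1 h)
    simp [Fin.val_add, Nat.mod_eq_of_lt (show 2 < n + 3 by omega)] at this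

variable [Fact p.Prime]

/-! ### Transversal lines and counting in the plane. -/

theorem natCast_fin_injective (hp : ℓ ≤ p) :
    Function.Injective fun i : Fin ℓ => ((i : ℕ) : ZMod p) := by
  intro i j h
  have := congrArg ZMod.val h
  simp only [ZMod.val_natCast_of_lt (i.2.trans_le hp),
    ZMod.val_natCast_of_lt (j.2.trans_le hp)] at this
  exact Fin.ext this

/-- Two consecutive directions are sides of a triangle inscribed in the parabola, and no three
distinct points of a parabola are collinear. -/
theorem dir_independent (hℓ : 3 ≤ ℓ) (hp : ℓ ≤ p) (i : Fin ℓ) {s s' : ZMod p}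
    (h : s • dir p i + s' • dir p (finRotate ℓ i) = 0) : s = 0 ∧ s' = 0 := by
  have hinj := natCast_fin_injective (p := p) hp
  have h1 := hinj.ne (finRotate_ne hℓ i).1
  have h2 := hinj.ne (finRotate_ne hℓ i).2
  have h3 := hinj.ne (finRotate_ne hℓ (finRotate ℓ i)).1
  have e1 := congrArg Prod.fst h
  have e2 := congrArg Prod.snd h
  simp only [dir, pt, Prod.fst_add, Prod.snd_add, Prod.smul_fst, Prod.smul_snd, Prod.fst_sub,
    Prod.snd_sub, smul_eq_mul, Prod.fst_zero, Prod.snd_zero] at e1 e2 h1 h2 h3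
  set a : ZMod p := ((i : ℕ) : ZMod p)
  set b : ZMod p := ((finRotate ℓ i : ℕ) : ZMod p)
  set c : ZMod p := ((finRotate ℓ (finRotate ℓ i) : ℕ) : ZMod p)
  have k1 : s * ((b - a) * (c - a)) = 0 := by linear_combination e2 - (b + c) * e1
  have k2 : s' * ((c - b) * (c - a)) = 0 := by linear_combination (a + b) * e1 - e2
  have hba := sub_ne_zero.2 h1
  have hca := sub_ne_zero.2 h2
  have hcb := sub_ne_zero.2 h3
  exact ⟨(mul_eq_zero.1 k1).resolve_right (mul_ne_zero hba hca),
    (mul_eq_zero.1 k2).resolve_right (mul_ne_zero hcb hca)⟩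

theorem combination_bijective (hℓ : 3 ≤ ℓ) (hp : ℓ ≤ p) (i : Fin ℓ) :
    Function.Bijective fun q : ZMod p × ZMod p => q.1 • dir p i + q.2 • dir p (finRotate ℓ i) := by
  rw [← Finite.injective_iff_bijective]
  intro q q' h
  obtain ⟨h1, h2⟩ := dir_independent hℓ hp i (s := q.1 - q'.1) (s' := q.2 - q'.2) (by
    rw [sub_smul, sub_smul, sub_add_sub_comm]
    exact sub_eq_zero.2 h)
  exact Prod.ext (sub_eq_zero.1 h1) (sub_eq_zero.1 h2)

/-- Zigzags of length less than `p` that start at the same point in different directions have no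
common edge. -/
theorem zigzag_disjoint (hℓ : 3 ≤ ℓ) (hp : ℓ ≤ p) {x : Plane p} {i j : Fin ℓ} {n m : ℕ}
    (hn : n < p) (hm : m < p) {e : Edge ℓ p} (hi : zigzag x i n e ≠ 0)
    (hj : zigzag x j m e ≠ 0) : i = j := by
  -- Different zigzags share an edge class only if their indices are consecutive. The common class
  -- then occurs on the first zigzag only at multiples 1, …, `n` of its direction, never at the
  -- starting point, where the two lines meet.
  have key : ∀ (i : Fin ℓ) (s s' : ℕ), s + 1 < p →
      x + ((s : ZMod p) + 1) • dir p i ≠ x + (s' : ZMod p) • dir p (finRotate ℓ i) := by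
    intro i s s' hs h
    have h0 := (dir_independent hℓ hp i (s := (s : ZMod p) + 1) (s' := -(s' : ZMod p)) (by
      rw [neg_smul, ← sub_eq_add_neg, sub_eq_zero]
      exact add_left_cancel h)).1
    have := congrArg ZMod.val h0
    rw [← Nat.cast_add_one, ZMod.val_natCast_of_lt hs] at this
    simp at this
  obtain ⟨s, hs, rfl | rfl⟩ := exists_of_zigzag_ne_zero hi <;>
  obtain ⟨s', hs', h | h⟩ := exists_of_zigzag_ne_zero hj
  · exact congrArg Prod.snd h
  · obtain rfl : i = _ := congrArg Prod.snd h
    exact (key j s' s (by omega) (congrArg Prod.fst h).symm).elim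
  · obtain rfl : _ = j := congrArg Prod.snd h
    exact (key i s s' (by omega) (congrArg Prod.fst h)).elim
  · exact (finRotate ℓ).injective (congrArg Prod.snd h)

/-- The point `x` lies on a line in one of the directions `dir p i` that misses `T`. -/
def Clean (ℓ : ℕ) (T : Set (Plane p)) (x : Plane p) : Prop :=
  ∃ i : Fin ℓ, ∀ s : ZMod p, x + s • dir p i ∉ T

theorem Clean.notMem {T : Set (Plane p)} {x : Plane p} (h : Clean ℓ T x) : x ∉ T := by
  obtain ⟨i, hi⟩ := h
  simpa using hi 0

/-- Finds the hub: the lines through points of `T` cover at most `k * ℓ * p` of the `p * p` points.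
-/
theorem exists_forall_line_notMem {T : Set (Plane p)} {k : ℕ} (hT : T.ncard ≤ k)
    (hp : k * ℓ < p) : ∃ x : Plane p, ∀ (i : Fin ℓ) (s : ZMod p), x + s • dir p i ∉ T := by
  by_contra! h
  choose i s h using h
  have hinj : Function.Injective fun x : Plane p => ((⟨_, h x⟩ : T), i x, s x) := by
    intro x y hxy
    simp only [Prod.mk.injEq, Subtype.mk.injEq] at hxy
    obtain ⟨h1, h2, h3⟩ := hxy
    rw [h2, h3] at h1
    exact add_right_cancel h1
  have hc := Nat.card_le_card_of_injective _ hinj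
  simp only [Nat.card_prod, Nat.card_zmod, Nat.card_coe_set_eq, Nat.card_fin, ← mul_assoc] at hc
  have hp0 := (Fact.out : p.Prime).pos
  have h1 : p ≤ T.ncard * ℓ := Nat.le_of_mul_le_mul_right hc hp0
  have h2 := Nat.mul_le_mul_right ℓ hT
  omega

/-- The `p` lines in the next direction through the points of the given line are pairwise disjoint,
so fewer than `p` points cannot meet them all. -/
theorem exists_clean_on_line (hℓ : 3 ≤ ℓ) (hp : ℓ ≤ p) {T : Set (Plane p)} (hT : T.ncard < p)
    (x : Plane p) (i : Fin ℓ) : ∃ n < p, Clean ℓ T (x + (n : ZMod p) • dir p i) := by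
  suffices ∃ s : ZMod p, Clean ℓ T (x + s • dir p i) by
    obtain ⟨s, hs⟩ := this
    exact ⟨s.val, s.val_lt, by rwa [ZMod.natCast_zmod_val]⟩
  by_contra! h
  simp only [Clean, not_exists, not_forall, not_not] at h
  choose s' hs' using fun s => h s (finRotate ℓ i)
  have hinj : Function.Injective fun s : ZMod p => (⟨_, hs' s⟩ : T) := by
    intro s r hsr
    have h1 := congrArg Subtype.val hsr
    simp only [add_assoc] at h1
    exact congrArg Prod.fst
      ((combination_bijective hℓ hp i).1 (a₁ := (s, s' s)) (a₂ := (r, s' r)) (add_left_cancel h1))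
  have hc := Nat.card_le_card_of_injective _ hinj
  rw [Nat.card_zmod, Nat.card_coe_set_eq] at hc
  omega

/-- A clean point is joined to any point all of whose lines miss `T` by a chain that avoids `T`. -/
theorem exists_chain_of_clean (hℓ : 3 ≤ ℓ) (hp : ℓ ≤ p) {T : Set (Plane p)} {x y : Plane p}
    (hx : Clean ℓ T x) (hy : ∀ (i : Fin ℓ) (s : ZMod p), y + s • dir p i ∉ T) :
    ∃ t : Edge ℓ p → ZMod 2, bdry t = charge x + charge y ∧ ∀ e : Edge ℓ p, e.1 ∈ T → t e = 0 := by
  obtain ⟨i, hi⟩ := hx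
  obtain ⟨⟨s, s'⟩, h⟩ := (combination_bijective hℓ hp i).2 (y - x)
  -- The clean line through `x` meets the line through `y` in the next direction; the chain turns at
  -- that intersection.
  have h' : x + ((s.val : ℕ) : ZMod p) • dir p i =
      y + (((-s').val : ℕ) : ZMod p) • dir p (finRotate ℓ i) := by
    simp only [ZMod.natCast_zmod_val, neg_smul]
    simp only at h
    rw [← sub_eq_add_neg, eq_sub_iff_add_eq, add_assoc, h, add_sub_cancel]
  refine ⟨zigzag x i s.val + zigzag y (finRotate ℓ i) (-s').val, ?_, fun e he => ?_⟩
  · rw [bdry_add, bdry_zigzag, bdry_zigzag, h', add_add_add_comm, charge_add_self, add_zero]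
  · rw [Pi.add_apply, zigzag_eq_zero hi _ he, zigzag_eq_zero (hy _) _ he, add_zero]

/-! ### The structures and the back-and-forth system -/

/-- The equations: the `ℓ` edges at the vertex `v` sum to `c v`. -/
def parityRelMap (c : Vert p → ZMod 2) :
    {n : ℕ} → ParityRel ℓ n → (Fin n → Carrier.{v} ℓ p) → Prop
  | _, .R₀, b => ∃ v, (∀ i, (b i).down.1 = inc v i) ∧ ∑ i, (b i).down.2 = c v
  | _, .R₁, b => ∃ v, (∀ i, (b i).down.1 = inc v i) ∧ ∑ i, (b i).down.2 = 1 + c v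

/-- The system of equations with the charge `c`, as a structure. -/
abbrev chargedStructure (c : Vert p → ZMod 2) : (parityLang ℓ).Structure (Carrier.{v} ℓ p) where
  funMap f _ := Empty.elim f
  RelMap R b := parityRelMap c R b

/-- The truth value of a formula in the system of equations with the charge `c`. -/
abbrev Holds [NeZero ℓ] {𝒬 : Set Quantifier.{v}} {k : ℕ} (c : Vert p → ZMod 2)
    (φ : QFormula.{u, v} (parityLang ℓ) 𝒬 k) (α : Fin k → Carrier.{v} ℓ p) : Prop :=
  @QFormula.Realize (parityLang ℓ) 𝒬 k (Carrier.{v} ℓ p) _ _ (chargedStructure c) φ α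

/-! ### Solvability of the charged systems. -/

theorem csp_zero [NeZero ℓ] : @CSP.{v} (parityLang ℓ) (ZMod 2) _ (Carrier.{v} ℓ p) _ _
    (chargedStructure 0) := by
  let _ : (parityLang ℓ).Structure (Carrier.{v} ℓ p) := chargedStructure 0
  refine ⟨⟨fun a => a.down.2, fun f => Empty.elim f, ?_⟩⟩
  rintro n (_ | _) b ⟨v, -, h⟩
  · exact h.trans rfl
  · exact h.trans (add_zero 1)

/-- Every edge is counted twice, once at its white end and once at its black end. -/
theorem sum_bdry (t : Edge ℓ p → ZMod 2) : ∑ v, bdry t v = 0 := by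
  simp only [bdry, Fintype.sum_sum_type, inc]
  rw [Finset.sum_comm, Finset.sum_comm (s := Finset.univ (α := Plane p)), ← Finset.sum_add_distrib]
  refine Finset.sum_eq_zero fun i _ => ?_
  rw [Fintype.sum_equiv (Equiv.subRight (pt p i)) (fun x => t (x - pt p i, i)) (fun x => t (x, i))
    fun _ => rfl]
  exact CharTwo.add_self_eq_zero _

theorem not_csp_charge [NeZero ℓ] (x : Plane p) :
    ¬ @CSP.{v} (parityLang ℓ) (ZMod 2) _ (Carrier.{v} ℓ p) _ _ (chargedStructure (charge x)) := by
  let _ : (parityLang ℓ).Structure (Carrier.{v} ℓ p) := chargedStructure (charge x)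
  rintro ⟨h⟩
  -- Restricting a solution to the copies with second component 0 gives a chain whose boundary is
  -- the charge.
  have hb : bdry (fun e : Edge ℓ p => h ⟨(e, 0)⟩) = charge x := by
    funext v
    have hz : ∀ z : ZMod 2, z = 0 ∨ z = 1 := by decide
    rcases hz (charge x v) with hv | hv
    · rw [hv]
      exact h.map_rel (ParityRel.R₀ : (parityLang ℓ).Relations ℓ) (fun i => ⟨(inc v i, 0)⟩)
        ⟨v, fun _ => rfl, by simp [hv]⟩
    · rw [hv]
      refine h.map_rel (ParityRel.R₁ : (parityLang ℓ).Relations ℓ) (fun i => ⟨(inc v i, 0)⟩)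
        ⟨v, fun _ => rfl, ?_⟩
      rw [hv]
      simp only [Finset.sum_const_zero]
      decide
  have := sum_bdry fun e : Edge ℓ p => h ⟨(e, 0)⟩
  rw [hb] at this
  simp [charge] at this

/-- Two assignments differ by a chain that is an isomorphism of the structures with charges
`c` and `c'` except at one vertex, which is white and clean for the edges in use. -/
def Linked {k : ℕ} (c c' : Vert p → ZMod 2) (α β : Fin k → Carrier.{v} ℓ p) : Prop :=
  ∃ t x, Clean ℓ (touched α) x ∧ bdry t = c + c' + charge x ∧ ∀ j, β j = shift t (α j)

theorem Linked.symm {k : ℕ} {c c' : Vert p → ZMod 2} {α β : Fin k → Carrier.{v} ℓ p}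
    (h : Linked c c' α β) : Linked c' c β α := by
  obtain ⟨t, x, hx, ht, hβ⟩ := h
  obtain rfl : β = fun j => shift t (α j) := funext hβ
  exact ⟨t, x, hx, by rw [ht, add_comm c], fun j => (shift_shift t _).symm⟩

/-- One round of the game: after a bijection `f` has been fixed, every assignment `β'` is
answered by `ℓ` assignments whose images under `f` differ from `β'` at pairwise disjoint places. -/
theorem Linked.exists_forall_answers {k : ℕ} (hℓ : 3 ≤ ℓ) (hp : ℓ ≤ p) (hkp : k * ℓ < p)
    {c c' : Vert p → ZMod 2} {α β : Fin k → Carrier.{v} ℓ p} (h : Linked c c' α β) :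
    ∃ f : Carrier.{v} ℓ p ≃ Carrier.{v} ℓ p, ∀ β' : Fin k → Carrier.{v} ℓ p,
      ∃ α' : Fin ℓ → Fin k → Carrier.{v} ℓ p, (∀ i, Linked c c' (α' i) β') ∧
        (∀ i j, β' j = β j → α' i j = α j) ∧
        ∀ j i i', f (α' i j) ≠ β' j → f (α' i' j) ≠ β' j → i = i' := by
  have hk : k < p := lt_of_le_of_lt (Nat.le_mul_of_pos_right k (by omega)) hkp
  obtain ⟨t, x, hx, ht, hβ⟩ := h
  obtain ⟨y, hy⟩ := exists_forall_line_notMem (touched_ncard_le α) hkp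
  obtain ⟨r, hr, hr0⟩ := exists_chain_of_clean hℓ hp hx hy
  -- This bijection parks the charge at `y`, and agrees with `t` on the edges in use because `r`
  -- vanishes there.
  refine ⟨shift (t + r), fun β' => ?_⟩
  choose n hn hclean using exists_clean_on_line hℓ hp ((touched_ncard_le β').trans_lt hk) y
  have hb : ∀ i, bdry (t + r + zigzag y i (n i)) =
      c + c' + charge (y + (n i : ZMod p) • dir p i) := by
    intro i
    rw [bdry_add, bdry_add, ht, hr, bdry_zigzag]
    linear_combination charge_add_self x + charge_add_self y
  refine ⟨fun i j => shift (t + r + zigzag y i (n i)) (β' j), fun i => ?_, fun i j hj => ?_,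
    fun j i i' hi hi' => ?_⟩
  · exact ⟨_, _, hclean i, hb i, fun j => (shift_shift _ _).symm⟩
  · have hm : (α j).down.1.1 ∈ touched α := ⟨j, rfl⟩
    beta_reduce
    rw [hj, hβ, add_assoc, add_comm t, shift_add, shift_shift]
    apply shift_eq_self
    rw [Pi.add_apply, hr0 _ hm, zigzag_eq_zero (hy i) _ hm, add_zero]
  · simp only [shift_add _ (zigzag _ _ _), shift_shift] at hi hi'
    exact zigzag_disjoint hℓ hp (hn i) (hn i') (fun h => hi (shift_eq_self h))
      (fun h => hi' (shift_eq_self h))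

/-- A tuple in a relation uses all edges at some vertex; a clean point is untouched, so that vertex
is not the defective one. -/
theorem Linked.relMap {k : ℕ} [NeZero ℓ] {c c' : Vert p → ZMod 2} {α β : Fin k → Carrier.{v} ℓ p}
    (h : Linked c c' α β) {n : ℕ} (R : ParityRel ℓ n) (x : Fin n → Fin k)
    (hR : parityRelMap c R fun j => α (x j)) : parityRelMap c' R fun j => β (x j) := by
  obtain ⟨t, w, hw, ht, hβ⟩ := h
  have key : ∀ (x : Fin ℓ → Fin k) (v : Vert p), (∀ i, (α (x i)).down.1 = inc v i) →
      (∀ i, (β (x i)).down.1 = inc v i) ∧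
        ∑ i, (β (x i)).down.2 = ∑ i, (α (x i)).down.2 + (c v + c' v) := by
    intro x v hv
    have hne : charge w v = 0 := by
      refine Pi.single_eq_of_ne ?_ _
      rintro rfl
      exact hw.notMem ⟨x 0, by simp only [hv]; rfl⟩
    refine ⟨fun i => by rw [hβ]; exact hv i, ?_⟩
    have := congrFun ht v
    simp only [Pi.add_apply, hne, add_zero] at this
    rw [← this, bdry, ← Finset.sum_add_distrib]
    refine Finset.sum_congr rfl fun i _ => ?_
    rw [hβ, shift_apply, hv]
  cases R with
  | R₀ =>
    obtain ⟨v, hv, hs⟩ := hR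
    refine ⟨v, (key x v hv).1, (key x v hv).2.trans ?_⟩
    rw [hs]
    linear_combination CharTwo.add_self_eq_zero (c v)
  | R₁ =>
    obtain ⟨v, hv, hs⟩ := hR
    refine ⟨v, (key x v hv).1, (key x v hv).2.trans ?_⟩
    rw [hs]
    linear_combination CharTwo.add_self_eq_zero (c v)

end Parity

theorem mem_nearUnanimity_of_forall_ne {ℓ : ℕ} (hℓ : 3 ≤ ℓ) {A : Type v} [Finite A]
    {a : Fin ℓ → A} {b : A} (h : ∀ i i', a i ≠ b → a i' ≠ b → i = i') :
    b ∈ nearUnanimity ℓ A a := by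
  rw [mem_nearUnanimity hℓ]
  have h1 := Set.ncard_add_ncard_compl {i | a i = b}
  have h2 : {i | a i = b}ᶜ.ncard ≤ 1 :=
    (Set.ncard_le_one (Set.toFinite _)).2 fun i hi i' hi' => h i i' hi hi'
  rw [Nat.card_fin] at h1
  omega

namespace Parity

variable {ℓ p : ℕ} [Fact p.Prime]

/-- Linked assignments satisfy the same formulas. -/
theorem Linked.holds [NeZero ℓ] (hℓ : 3 ≤ ℓ) {k : ℕ} (hp : ℓ ≤ p) (hkp : k * ℓ < p)
    (φ : QFormula.{u, v} (parityLang ℓ) (closedQuantifiers (nearUnanimity.{v} ℓ)) k) :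
    ∀ {c c' : Vert p → ZMod 2} {α β : Fin k → Carrier.{v} ℓ p}, Linked c c' α β →
      Holds c φ α → Holds c' φ β := by
  -- For first-order quantifiers a single one of the `ℓ` answers suffices.
  have forth : ∀ {c c' : Vert p → ZMod 2} {α β : Fin k → Carrier.{v} ℓ p}, Linked c c' α β →
      ∀ x b, ∃ a, Linked c c' (Function.update α x a) (Function.update β x b) := by
    intro c c' α β h x b
    obtain ⟨f, hf⟩ := h.exists_forall_answers hℓ hp hkp
    obtain ⟨α', hL, hα, -⟩ := hf (Function.update β x b)
    refine ⟨α' 0 x, ?_⟩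
    convert hL 0
    funext j
    by_cases hj : j = x
    · subst hj
      simp
    · rw [Function.update_of_ne hj, hα 0 j (Function.update_of_ne hj _ _)]
  induction φ with
  | equal x y =>
    rintro c c' α β ⟨t, -, -, -, hβ⟩ h
    change β x = β y
    rw [hβ, hβ, show α x = α y from h]
  | rel R x =>
    intro c c' α β h hR
    exact h.relMap R x hR
  | neg φ ih => exact fun h hα hβ => hα (ih h.symm hβ)
  | conj φ ih => exact fun h hα i => ih i h (hα i)
  | disj φ ih =>
    rintro c c' α β h ⟨i, hα⟩
    exact ⟨i, ih i h hα⟩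
  | ex x φ ih =>
    rintro c c' α β h ⟨a, hα⟩
    obtain ⟨b, hb⟩ := forth h.symm x a
    exact ⟨b, ih hb.symm hα⟩
  | all x φ ih =>
    intro c c' α β h hα b
    obtain ⟨a, ha⟩ := forth h x b
    exact ih ha (hα a)
  | quant Q hQ y ψ ih =>
    intro c c' α β h hα
    obtain ⟨f, hf⟩ := h.exists_forall_answers hℓ hp hkp
    let S : ∀ r, Q.vocab.Relations r → Set (Fin r → Carrier.{v} ℓ p) :=
      fun r R => {b | Holds c (ψ r R) (Function.extend (y r R) b α)}
    -- The structure defined under `α`, transported along `f`; it lies in the class by isomorphism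
    -- invariance.
    let 𝔅 : Q.vocab.Structure (Carrier.{v} ℓ p) :=
      structureOfRel Q.vocab Q.relational fun r R => {b | f.symm ∘ b ∈ S r R}
    let e : @FirstOrder.Language.Equiv Q.vocab (Carrier.{v} ℓ p) (Carrier.{v} ℓ p)
        (structureOfRel Q.vocab Q.relational S) 𝔅 :=
      @FirstOrder.Language.Equiv.mk _ _ _ (structureOfRel Q.vocab Q.relational S) 𝔅 f
        (fun {n} g _ => ((Q.relational n).false g).elim) (fun R b => by
          change f.symm ∘ f ∘ b ∈ S _ R ↔ b ∈ S _ R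
          rw [← Function.comp_assoc, f.symm_comp_self, Function.id_comp])
    have hB : @Quantifier.mem Q _ _ _ 𝔅 :=
      @Quantifier.mem_of_equiv Q _ _ _ _ _ _ (structureOfRel Q.vocab Q.relational S) 𝔅 e hα
    refine hQ _ _ 𝔅 hB fun r R b hb => Or.inl ?_
    obtain ⟨α', hL, hα', hu⟩ := hf (Function.extend (y r R) b β)
    refine ⟨fun i => f ∘ α' i ∘ y r R, fun i => ?_, fun j => ?_⟩
    · change f.symm ∘ f ∘ α' i ∘ y r R ∈ S r R
      rw [← Function.comp_assoc, f.symm_comp_self, Function.id_comp]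
      have hext : Function.extend (y r R) (α' i ∘ y r R) α = α' i := by
        funext j
        by_cases hj : ∃ m, y r R m = j
        · obtain ⟨m, rfl⟩ := hj
          rw [(y r R).injective.extend_apply, Function.comp_apply]
        · rw [Function.extend_apply' _ _ _ hj, hα' i j (Function.extend_apply' _ _ _ hj)]
      change Holds c (ψ r R) _
      rw [hext]
      exact ih r R (hL i).symm hb
    · apply mem_nearUnanimity_of_forall_ne hℓ
      have := hu (y r R j)
      rwa [(y r R).injective.extend_apply] at this

end Parity

end GenQuant

theorem mainTheorem1 (ℓ : ℕ) (hℓ : 3 ≤ ℓ) :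
    ¬ GenQuant.IsDefinable.{u, v} (GenQuant.closedQuantifiers (GenQuant.nearUnanimity.{v} ℓ))
        (GenQuant.CSP.{v} (GenQuant.parityLang ℓ) (ZMod 2)) := by
  open GenQuant GenQuant.Parity in
  rintro ⟨k, φ, -, hφ⟩
  obtain ⟨p, hp, hprime⟩ := Nat.exists_infinite_primes (k * ℓ + ℓ + 1)
  have : Fact p.Prime := ⟨hprime⟩
  have : NeZero ℓ := ⟨by omega⟩
  have h0 := (@hφ (Carrier.{v} ℓ p) _ _ (chargedStructure 0)).1 csp_zero
  refine not_csp_charge.{v} (ℓ := ℓ) (0 : Plane p)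
    ((@hφ (Carrier.{v} ℓ p) _ _ (chargedStructure (charge 0))).2 fun β => ?_)
  -- For each assignment the charge is moved from the origin to a point clean for it. The chain need
  -- not avoid anything, as the second assignment is free to be its image.
  obtain ⟨y, hy⟩ := exists_forall_line_notMem (touched_ncard_le β) (by omega : k * ℓ < p)
  have hclean : Clean ℓ (∅ : Set (Plane p)) (0 : Plane p) := ⟨0, fun _ => Set.notMem_empty _⟩
  obtain ⟨t, ht, -⟩ := exists_chain_of_clean hℓ (by omega) hclean (y := y)
    fun _ _ => Set.notMem_empty _
  have hL : Linked (charge 0) 0 β fun j => shift t (β j) :=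
    ⟨t, y, ⟨0, hy 0⟩, by rw [ht, add_zero], fun _ => rfl⟩
  exact hL.symm.holds hℓ (by omega) (by omega) φ (h0 _)
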